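/- Let $k,m\ge 1$, $n=k+m$, and let $\lambda_1,\dots,\lambda_n:[0,1]\to\mathbb R$ be Lipschitz functions with $$-\lambda_1(x)<\dots<-\lambda_k(x)<0<\lambda_{k+1}(x)<\dots<\lambda_{k+m}(x)\qquad (x\in[0,1]).$$ Put $\Sigma=\mathrm{diag}(-\lambda_1,\dots,-\lambda_k,\lambda_{k+1},\dots,\lambda_{k+m})$, $\tau_i=\int_0^1\frac{d\xi}{\lambda_i(\xi)}$, and $$T_{opt}=\begin{cases}\max\{\tau_1+\tau_{m+1},\dots,\tau_k+\tau_{m+k},\ \tau_{k+1}\} & \text{if } m\ge k,\\ \max\{\tau_{k+1-m}+\tau_{k+1},\ \tau_{k+2-m}+\tau_{k+2},\dots,\tau_k+\tau_{k+m}\} & \text{if } m<k.\end{cases}$$ Let $B\in\mathbb R^{k\times m}$ be such that, for every $1\le i\le\min\{k,m\}$, the $i\times i$ matrix formed from the last $i$ rows and the last $i$ columns of $B$ is invertible. For an initial datum $w_0$, a time $T\ge0$ and a control $W:(0,T)\to\mathbb R^m$, consider the system $$\partial_t w=\Sigma(x)\,\partial_x w \ \text{ in } (0,T)\times(0,1),\qquad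 w_-(t,0)=B\,w_+(t,0),\qquad w_+(t,1)=W(t),\qquad w(0,\cdot)=w_0,$$ where $w_-=(w_1,\dots,w_k)^{\mathsf T}$ and $w_+=(w_{k+1},\dots,w_{k+m})^{\mathsf T}$. A solution is a broad solution: $w\in C([0,T];L^2(0,1)^n)\cap C([0,1];L^2(0,T)^n)$, the initial and boundary conditions hold almost everywhere, and for each $i$ and almost every $(t,x)$ the value $w_i(t,x)$ equals the value of $w_i$ at the point where the characteristic of the $i$-th equation through $(t,x)$ enters $[0,T]\times[0,1]$. Then for every $T$ with $0\le T<T_{opt}$ there is an initial datum $w_0\in L^\infty(0,1)^n$ such that, for every control $W\in L^2(0,T)^m$, a solution exists and every solution satisfies $w(T,\cdot)\not\equiv0$ (that is, $w(T,\cdot)$ is not almost everywhere zero). In particular, at no time $T<T_{opt}$ is the system null-controllable, neither with data in $L^2(0,1)^n$ and controls in $L^2(0,T)^m$ nor with data in $L^\infty(0,1)^n$ and controls in $L^\infty(0,T)^m$. (Null-controllable at time $T$ means that every initial datum admits a control for which the solution vanishes at time $T$.) -/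

import Mathlib

open Set Filter Topology MeasureTheory
open scoped ENNReal NNReal Matrix

noncomputable section

namespace HypControl

/-- The `n = k + m` components of the state: `Sum.inl i` (with `i : Fin k`) is the `(i+1)`-th
component, and `Sum.inr j` (with `j : Fin m`) is the `(k+j+1)`-th component. -/
abbrev Idx (k m : ℕ) : Type := Fin k ⊕ Fin m

/-- Standing assumptions on the speeds: on `[0,1]`,
`-λ_1 < ⋯ < -λ_k < 0 < λ_{k+1} < ⋯ < λ_{k+m}`, and every `λ_i` is Lipschitz. -/
structure AdmissibleSpeeds {k m : ℕ} (lam : Idx k m → ℝ → ℝ) : Prop where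
  lipschitz : ∀ i, ∃ K : ℝ≥0, LipschitzOnWith K (lam i) (Icc 0 1)
  pos : ∀ i, ∀ x ∈ Icc (0 : ℝ) 1, 0 < lam i x
  strict_neg : ∀ x ∈ Icc (0 : ℝ) 1, ∀ i j : Fin k, i < j →
    -lam (Sum.inl i) x < -lam (Sum.inl j) x
  strict_pos : ∀ x ∈ Icc (0 : ℝ) 1, ∀ i j : Fin m, i < j →
    lam (Sum.inr i) x < lam (Sum.inr j) x

/-- The diagonal entries of `Σ(x) = diag(-λ_1, …, -λ_k, λ_{k+1}, …, λ_{k+m})`. -/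
def sigma {k m : ℕ} (lam : Idx k m → ℝ → ℝ) : Idx k m → ℝ → ℝ
  | Sum.inl i => fun x => -lam (Sum.inl i) x
  | Sum.inr j => fun x => lam (Sum.inr j) x

/-- The travel times `τ_i = ∫_0^1 dξ / λ_i(ξ)`. -/
def tau {k m : ℕ} (lam : Idx k m → ℝ → ℝ) (i : Idx k m) : ℝ :=
  ∫ ξ in (0 : ℝ)..1, 1 / lam i ξ

/-- The time `T_opt`. If `m ≥ k` it is
`max {τ_1 + τ_{m+1}, …, τ_k + τ_{m+k}, τ_{k+1}}`, and if `m < k` it is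
`max {τ_{k+1-m} + τ_{k+1}, …, τ_k + τ_{k+m}}` (the suprema are over finite nonempty sets). -/
def optimalTime {k m : ℕ} [NeZero m] (lam : Idx k m → ℝ → ℝ) : ℝ :=
  if h : k ≤ m then
    max (⨆ i : Fin k, (tau lam (Sum.inl i) + tau lam (Sum.inr ⟨m - k + i, by omega⟩)))
      (tau lam (Sum.inr 0))
  else
    ⨆ j : Fin m, (tau lam (Sum.inl ⟨k - m + j, by omega⟩) + tau lam (Sum.inr j))

/-- The `i × i` matrix formed from the last `i` rows and the last `i` columns of `B`. -/
def trailingBlock {k m : ℕ} (B : Matrix (Fin k) (Fin m) ℝ) (i : ℕ) (hk : i ≤ k) (hm : i ≤ m) :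
    Matrix (Fin i) (Fin i) ℝ :=
  B.submatrix (fun a => ⟨k - i + a, by omega⟩) (fun b => ⟨m - i + b, by omega⟩)

/-- `γ` is, on the time interval `[s, t]`, a characteristic curve in `[0,1]` of the `i`-th equation
of `∂_t w = Σ ∂_x w + C w`, that is, `γ' = -Σ_{ii}(γ)`. -/
def IsCharacteristic {k m : ℕ} (lam : Idx k m → ℝ → ℝ) (i : Idx k m) (γ : ℝ → ℝ) (s t : ℝ) :
    Prop :=
  s ≤ t ∧ ∀ r ∈ Icc s t, γ r ∈ Icc (0 : ℝ) 1 ∧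
    HasDerivWithinAt γ (-sigma lam i (γ r)) (Icc s t) r

/-- The end point of `[0,1]` at which the characteristics of the `i`-th equation enter. -/
def inflow {k m : ℕ} : Idx k m → ℝ
  | Sum.inl _ => 0
  | Sum.inr _ => 1

/-- Broad solutions on `[0,T] × [0,1]` of
`∂_t w = Σ(x) ∂_x w + C(x) w`, `w_-(t,0) = B w_+(t,0)`, `w_+(t,1) = W(t)`, `w(0,x) = w₀(x)`.
The function `w` belongs to `C([0,T]; L²(0,1))` and to `C([0,1]; L²(0,T))`, so that its restrictions
to the lines `t = const` and `x = const` are meaningful; the initial and boundary conditions hold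
almost everywhere; and the equation holds in integrated form along the characteristic through
almost every point `(t, x)`, from the point where that characteristic enters the domain (at time
`0` or through the inflow end point). -/
structure IsBroadSolution {k m : ℕ} (lam : Idx k m → ℝ → ℝ)
    (C : ℝ → Matrix (Idx k m) (Idx k m) ℝ) (B : Matrix (Fin k) (Fin m) ℝ) (T : ℝ)
    (w₀ : ℝ → Idx k m → ℝ) (W : ℝ → Fin m → ℝ) (w : ℝ → ℝ → Idx k m → ℝ) : Prop where
  memLp : ∀ i, MemLp (fun p : ℝ × ℝ => w p.1 p.2 i) 2
    (volume.restrict (Ioo 0 T ×ˢ Ioo 0 1))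
  memLp_space : ∀ i, ∀ t ∈ Icc 0 T,
    MemLp (fun x => w t x i) 2 (volume.restrict (Ioo 0 1))
  continuous_time : ∀ i, ∀ t₀ ∈ Icc 0 T,
    Tendsto (fun t => eLpNorm (fun x => w t x i - w t₀ x i) 2 (volume.restrict (Ioo 0 1)))
      (𝓝[Icc 0 T] t₀) (𝓝 0)
  memLp_time : ∀ i, ∀ x ∈ Icc (0 : ℝ) 1,
    MemLp (fun t => w t x i) 2 (volume.restrict (Ioo 0 T))
  continuous_space : ∀ i, ∀ x₀ ∈ Icc (0 : ℝ) 1,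
    Tendsto (fun x => eLpNorm (fun t => w t x i - w t x₀ i) 2 (volume.restrict (Ioo 0 T)))
      (𝓝[Icc 0 1] x₀) (𝓝 0)
  initial : ∀ᵐ x ∂(volume.restrict (Ioo (0 : ℝ) 1)), w 0 x = w₀ x
  boundary_zero : ∀ᵐ t ∂(volume.restrict (Ioo 0 T)), ∀ i : Fin k,
    w t 0 (Sum.inl i) = ∑ j : Fin m, B i j * w t 0 (Sum.inr j)
  boundary_one : ∀ᵐ t ∂(volume.restrict (Ioo 0 T)), ∀ j : Fin m, w t 1 (Sum.inr j) = W t j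
  equation : ∀ i, ∀ᵐ p : ℝ × ℝ ∂(volume.restrict (Ioo 0 T ×ˢ Ioo 0 1)),
    ∀ (s : ℝ) (γ : ℝ → ℝ), 0 ≤ s → IsCharacteristic lam i γ s p.1 → γ p.1 = p.2 →
      (s = 0 ∨ γ s = inflow i) →
      w p.1 p.2 i = w s (γ s) i + ∫ r in s..p.1, ∑ j, C (γ r) i j * w r (γ r) j

/-- Null-controllability at the time `T`, with initial data in `L^p(0,1)` and controls in
`L^p(0,T)`. -/
def NullControllable {k m : ℕ} (lam : Idx k m → ℝ → ℝ)
    (C : ℝ → Matrix (Idx k m) (Idx k m) ℝ) (B : Matrix (Fin k) (Fin m) ℝ) (p : ℝ≥0∞) (T : ℝ) :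
    Prop :=
  ∀ w₀ : ℝ → Idx k m → ℝ, (∀ i, MemLp (fun x => w₀ x i) p (volume.restrict (Ioo 0 1))) →
    ∃ W : ℝ → Fin m → ℝ, (∀ j, MemLp (fun t => W t j) p (volume.restrict (Ioo 0 T))) ∧
      ∃ w : ℝ → ℝ → Idx k m → ℝ, IsBroadSolution lam C B T w₀ W w ∧
        ∀ᵐ x ∂(volume.restrict (Ioo (0 : ℝ) 1)), w T x = 0

end HypControl

end

/-! The obstruction is finite speed of propagation, tested on a datum that is a constant unit
vector. `lt_of_lt_optimalTime` leaves two cases. If `T` is below the largest crossing time among the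
components entering at `x = 1`, the initial value 1 of that component is still visible near `x = 0`
at time `T` (`not_ae_eq_zero_of_lt_tau_inr`).

Otherwise, for some `p`, `T < α + β`, where `α` and `β` are the crossing times of the zero-based
components `k - p` of `w_-` and `m - p` of `w_+`. Take the unit vector in the latter component. At
`x = 0`, before time `β`, the components `j ≤ m - p` of `w_+` still have their initial values
(`inr_trace_zero`). After time `T - α`, the last `p` components of `w_-` at `x = 0` must vanish if
the state vanishes at time `T` (`inl_trace_zero`). These two time windows overlap inside `(0, T)`.
There the boundary condition puts a vector with leading entries `0, …, 0, 1` into the kernel of the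
last `p` rows of `B`, contradicting invertibility of the trailing block
(`not_ae_eq_zero_of_lt_tau_add`).

Since the equation holds only almost everywhere, boundary values are reached through the two `L²`
continuity conditions. Existence comes from explicit travelling waves (`exists_isBroadSolution`). -/

namespace HypControl

/-! ### Travel-time coordinates -/

/-- `φ` is an increasing bi-Lipschitz bijection of the line which on `[0,1]` is the primitive
`x ↦ ∫_0^x dξ / l(ξ)`. -/
structure IsTravelTime (l : ℝ → ℝ) (K : ℝ≥0) (φ : ℝ ≃o ℝ) : Prop where
  map_zero : φ 0 = 0
  map_one : φ 1 = ∫ ξ in (0 : ℝ)..1, 1 / l ξ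
  hasDerivAt : ∀ x ∈ Icc (0 : ℝ) 1, HasDerivAt φ (1 / l x) x
  hasDerivAt_symm : ∀ y, φ.symm y ∈ Icc (0 : ℝ) 1 → HasDerivAt φ.symm (l (φ.symm y)) y
  lipschitz : LipschitzWith K φ
  lipschitz_symm : LipschitzWith K φ.symm

/-- Freezing `l` at its endpoint values outside `[0,1]` gives a continuous function between two
positive constants. The primitive of its reciprocal is then a global bi-Lipschitz bijection, with
two-sided derivatives even at 0 and 1. -/
theorem exists_isTravelTime {l : ℝ → ℝ} (hc : ContinuousOn l (Icc 0 1))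
    (hpos : ∀ x ∈ Icc (0 : ℝ) 1, 0 < l x) : ∃ (K : ℝ≥0) (φ : ℝ ≃o ℝ), IsTravelTime l K φ := by
  set g : ℝ → ℝ := fun x => l (projIcc 0 1 zero_le_one x) with hg
  have hgc : Continuous g :=
    hc.comp_continuous (continuous_subtype_val.comp continuous_projIcc) fun x => Subtype.prop _
  have hgl : ∀ x ∈ Icc (0 : ℝ) 1, g x = l x := fun x hx => by
    simp [hg, projIcc_of_mem zero_le_one hx]
  obtain ⟨xa, hxa, ha⟩ := isCompact_Icc.exists_isMinOn (nonempty_Icc.2 zero_le_one) hc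
  obtain ⟨xb, hxb, hb⟩ := isCompact_Icc.exists_isMaxOn (nonempty_Icc.2 zero_le_one) hc
  have hga : ∀ x, l xa ≤ g x := fun x => ha (Subtype.prop (projIcc 0 1 zero_le_one x))
  have hgb : ∀ x, g x ≤ l xb := fun x => hb (Subtype.prop (projIcc 0 1 zero_le_one x))
  have hapos := hpos xa hxa
  have hbpos := hpos xb hxb
  have hgpos : ∀ x, 0 < g x := fun x => hapos.trans_le (hga x)
  have hinv : Continuous fun x => 1 / g x :=
    continuous_const.div hgc fun x => (hgpos x).ne'
  set f : ℝ → ℝ := fun x => ∫ ξ in (0 : ℝ)..x, 1 / g ξ with hf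
  have hfd : ∀ x, HasDerivAt f (1 / g x) x := fun x =>
    intervalIntegral.integral_hasDerivAt_right (hinv.intervalIntegrable _ _)
      (hinv.stronglyMeasurableAtFilter _ _) hinv.continuousAt
  have hmono : StrictMono f := strictMono_of_deriv_pos fun x => by
    rw [(hfd x).deriv]; exact one_div_pos.2 (hgpos x)
  have hdiff : Differentiable ℝ f := fun x => (hfd x).differentiableAt
  -- Comparison with the line of slope `1 / max l` forces `f` to be unbounded in both directions.
  have hlow : Monotone fun x => f x - (1 / l xb) * x := by
    apply monotone_of_deriv_nonneg
    · exact hdiff.sub (differentiable_id.const_mul _)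
    · intro x
      have h := (hfd x).sub ((hasDerivAt_id x).const_mul (1 / l xb))
      have h' : deriv (fun x => f x - (1 / l xb) * x) x = 1 / g x - 1 / l xb * 1 := h.deriv
      rw [h', mul_one, sub_nonneg]
      exact one_div_le_one_div_of_le (hgpos x) (hgb x)
  have hf0 : f 0 = 0 := by simp [hf]
  have hbinv : 0 < 1 / l xb := one_div_pos.2 hbpos
  have hsurj : Function.Surjective f := by
    apply hdiff.continuous.surjective
    · refine tendsto_atTop_mono' atTop ?_ (tendsto_id.const_mul_atTop hbinv)
      filter_upwards [eventually_ge_atTop 0] with x hx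
      have := hlow hx
      simp only [hf0] at this
      simp only [id]; linarith
    · refine tendsto_atBot_mono' atBot ?_ (tendsto_id.const_mul_atBot hbinv)
      filter_upwards [eventually_le_atBot 0] with x hx
      have := hlow hx
      simp only [hf0] at this
      simp only [id]; linarith
  set φ : ℝ ≃o ℝ := hmono.orderIsoOfSurjective f hsurj with hφ
  have hφf : ∀ x, φ x = f x := fun x => rfl
  have hsd : ∀ y, HasDerivAt φ.symm (g (φ.symm y)) y := fun y => by
    have h := HasDerivAt.of_local_left_inverse (f := f) (g := φ.symm) (a := y)
      φ.symm.continuous.continuousAt (hfd (φ.symm y)) (one_div_pos.2 (hgpos _)).ne'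
      (Eventually.of_forall fun z => φ.apply_symm_apply z)
    simpa using h
  refine ⟨max (1 / l xa).toNNReal (l xb).toNNReal, φ, ?_, ?_, ?_, ?_, ?_, ?_⟩
  · exact hf0
  · refine intervalIntegral.integral_congr fun x hx => ?_
    rw [uIcc_of_le zero_le_one] at hx
    simp only [hgl x hx]
  · intro x hx
    rw [← hgl x hx]
    exact hfd x
  · intro y hy
    rw [← hgl _ hy]
    exact hsd y
  · refine (lipschitzWith_of_nnnorm_deriv_le (C := (1 / l xa).toNNReal) hdiff fun x => ?_).weaken
      (le_max_left _ _)
    rw [(hfd x).deriv, ← NNReal.coe_le_coe, coe_nnnorm, Real.norm_eq_abs,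
      abs_of_pos (one_div_pos.2 (hgpos x)), Real.coe_toNNReal _ (one_div_pos.2 hapos).le]
    exact one_div_le_one_div_of_le hapos (hga x)
  · refine (lipschitzWith_of_nnnorm_deriv_le (C := (l xb).toNNReal)
      (fun y => (hsd y).differentiableAt) fun y => ?_).weaken (le_max_right _ _)
    rw [(hsd y).deriv, ← NNReal.coe_le_coe, coe_nnnorm, Real.norm_eq_abs,
      abs_of_pos (hgpos _), Real.coe_toNNReal _ hbpos.le]
    exact hgb _

/-- A bijection of the line with Lipschitz inverse distorts Lebesgue measure boundedly. -/
theorem map_volume_le (e : ℝ ≃o ℝ) {K : ℝ≥0} (h : LipschitzWith K e.symm) :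
    Measure.map e volume ≤ (K : ℝ≥0∞) • (volume : Measure ℝ) := by
  refine Measure.le_iff.2 fun s hs => ?_
  rw [Measure.map_apply e.continuous.measurable hs, Measure.smul_apply, smul_eq_mul,
    -- Lebesgue measure is one-dimensional Hausdorff measure, which a `K`-Lipschitz map enlarges by
    -- at most the factor `K`.
    ← e.symm_symm, ← e.symm.image_eq_preimage_symm, ← hausdorffMeasure_real]
  have := h.hausdorffMeasure_image_le zero_le_one s
  simpa using this

namespace IsTravelTime

variable {l : ℝ → ℝ} {K : ℝ≥0} {φ : ℝ ≃o ℝ}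

theorem map_le (h : IsTravelTime l K φ) :
    Measure.map φ volume ≤ (K : ℝ≥0∞) • (volume : Measure ℝ) :=
  map_volume_le φ h.lipschitz_symm

theorem map_symm_le (h : IsTravelTime l K φ) :
    Measure.map φ.symm volume ≤ (K : ℝ≥0∞) • (volume : Measure ℝ) :=
  map_volume_le φ.symm (by simpa using h.lipschitz)

theorem quasiMeasurePreserving (h : IsTravelTime l K φ) :
    Measure.QuasiMeasurePreserving φ volume volume :=
  ⟨φ.continuous.measurable, h.map_le.absolutelyContinuous.trans
    Measure.smul_absolutelyContinuous⟩

theorem quasiMeasurePreserving_symm (h : IsTravelTime l K φ) :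
    Measure.QuasiMeasurePreserving φ.symm volume volume :=
  ⟨φ.symm.continuous.measurable, h.map_symm_le.absolutelyContinuous.trans
    Measure.smul_absolutelyContinuous⟩

theorem map_one_pos (h : IsTravelTime l K φ) : 0 < φ 1 := by
  rw [← h.map_zero]; exact φ.strictMono one_pos

/-- The travel time grows at unit rate along solutions of `γ' = l(γ)`. -/
theorem apply_sub_eq (h : IsTravelTime l K φ) {γ : ℝ → ℝ} {s t ε : ℝ}
    (hst : s ≤ t) (hl : ∀ x ∈ Icc (0 : ℝ) 1, 0 < l x)
    (hγ : ∀ r ∈ Icc s t, γ r ∈ Icc (0 : ℝ) 1 ∧ HasDerivWithinAt γ (ε * l (γ r)) (Icc s t) r) :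
    φ (γ t) - ε * t = φ (γ s) - ε * s := by
  have hd : ∀ r ∈ Icc s t, HasDerivWithinAt (fun r => φ (γ r) - ε * r) 0 (Icc s t) r := by
    intro r hr
    have h1 := (h.hasDerivAt _ (hγ r hr).1).comp_hasDerivWithinAt r (hγ r hr).2
    have h2 := h1.sub ((hasDerivWithinAt_id r (Icc s t)).const_mul ε)
    have hne := (hl _ (hγ r hr).1).ne'
    have h0 : 1 / l (γ r) * (ε * l (γ r)) - ε * 1 = 0 := by
      field_simp
      ring
    rwa [h0] at h2
  refine constant_of_has_deriv_right_zero (fun r hr => (hd r hr).continuousWithinAt) ?_ t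
    (right_mem_Icc.2 hst)
  intro r hr
  exact ((hd r (Ico_subset_Icc_self hr)).mono (Icc_subset_Icc_left hr.1)).mono_of_mem_nhdsWithin
    (Icc_mem_nhdsGE hr.2)

/-- The curves `γ` with `φ(γ(r)) = c + ε r` solve `γ' = ε l(γ)`. -/
theorem hasDerivWithinAt_symm (h : IsTravelTime l K φ) (c ε r : ℝ) (S : Set ℝ)
    (hr : φ.symm (c + ε * r) ∈ Icc (0 : ℝ) 1) :
    HasDerivWithinAt (fun r => φ.symm (c + ε * r)) (ε * l (φ.symm (c + ε * r))) S r := by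
  have h1 : HasDerivAt (fun r : ℝ => c + ε * r) ε r := by
    simpa using ((hasDerivAt_id r).const_mul ε).const_add c
  have := ((h.hasDerivAt_symm _ hr).comp r h1).hasDerivWithinAt (s := S)
  rwa [mul_comm] at this

theorem symm_mem_Icc (h : IsTravelTime l K φ) {y : ℝ} :
    φ.symm y ∈ Icc (0 : ℝ) 1 ↔ y ∈ Icc 0 (φ 1) := by
  rw [mem_Icc, mem_Icc, φ.le_symm_apply, φ.symm_apply_le, h.map_zero]

theorem symm_mem_Ioo (h : IsTravelTime l K φ) {y : ℝ} :
    φ.symm y ∈ Ioo (0 : ℝ) 1 ↔ y ∈ Ioo 0 (φ 1) := by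
  rw [mem_Ioo, mem_Ioo, φ.lt_symm_apply, φ.symm_apply_lt, h.map_zero]

end IsTravelTime

/-! ### Measure-theoretic preliminaries -/

/-- Every relative neighbourhood of a point of `[0, L]`, endpoints included, meets `(0, L)` in a
nonempty open set, hence in positive measure. This supplies good slices converging to a boundary
line. -/
theorem frequently_nhdsWithin_of_ae {L a : ℝ} (hL : 0 < L) (ha : a ∈ Icc 0 L) {P : ℝ → Prop}
    (hP : ∀ᵐ x ∂(volume.restrict (Ioo 0 L)), P x) :
    ∃ᶠ x in 𝓝[Icc 0 L] a, x ∈ Ioo 0 L ∧ P x := by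
  intro hcon
  rw [eventually_iff, mem_nhdsWithin] at hcon
  obtain ⟨U, hU, haU, hsub⟩ := hcon
  rw [← closure_Ioo hL.ne] at ha
  have hne : (U ∩ Ioo 0 L).Nonempty := mem_closure_iff.1 ha U hU haU
  have hpos : 0 < volume (U ∩ Ioo 0 L) := (hU.inter isOpen_Ioo).measure_pos _ hne
  rw [ae_restrict_iff' measurableSet_Ioo, ae_iff] at hP
  refine hpos.ne' (measure_mono_null (fun x hx => ?_) hP)
  have := hsub ⟨hx.1, Ioo_subset_Icc_self hx.2⟩
  exact fun h => this ⟨hx.2, h hx.2⟩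

theorem eq_zero_of_frequently_le {α : Type*} {l : Filter α} {e : α → ℝ≥0∞} {q c : ℝ≥0∞}
    (hc : c ≠ ∞) (he : Tendsto e l (𝓝 0)) (h : ∃ᶠ a in l, q ≤ c * e a) : q = 0 := by
  have ht : Tendsto (fun a => c * e a) l (𝓝 0) := by
    simpa using ENNReal.Tendsto.const_mul he (Or.inr hc)
  by_contra hq
  obtain ⟨a, h1, h2⟩ := (h.and_eventually (ht.eventually_lt_const (pos_iff_ne_zero.2 hq))).exists
  exact absurd h2 h1.not_gt

/-- If `f a` equals `c` on `S` for parameters `a` arbitrarily close to `a₀`, and `f a → f a₀` in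
`L²(R)` with `S ⊆ R`, then `f a₀` equals `c` on `S`. -/
theorem ae_eq_const_of_tendsto {α : Type*} {l : Filter α} {f : α → ℝ → ℝ} {f₀ : ℝ → ℝ} {c : ℝ}
    {R S : Set ℝ} (hSR : S ⊆ R) (hm : AEStronglyMeasurable f₀ (volume.restrict R))
    (ht : Tendsto (fun a => eLpNorm (fun y => f a y - f₀ y) 2 (volume.restrict R)) l (𝓝 0))
    (hf : ∃ᶠ a in l, ∀ᵐ y ∂(volume.restrict S), f a y = c) :
    ∀ᵐ y ∂(volume.restrict S), f₀ y = c := by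
  have hmS : AEStronglyMeasurable (fun y => c - f₀ y) (volume.restrict S) :=
    aestronglyMeasurable_const.sub (hm.mono_set hSR)
  have h0 : eLpNorm (fun y => c - f₀ y) 2 (volume.restrict S) = 0 := by
    refine eq_zero_of_frequently_le ENNReal.one_ne_top ht (hf.mono fun a ha => ?_)
    rw [one_mul, eLpNorm_congr_ae (g := fun y => f a y - f₀ y)
      (ha.mono fun y hy => by simp only [hy])]
    exact eLpNorm_mono_measure _ (Measure.restrict_mono hSR le_rfl)
  rw [eLpNorm_eq_zero_iff hmS two_ne_zero] at h0
  filter_upwards [h0] with y hy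
  simp only [Pi.zero_apply] at hy
  linarith

theorem eLpNorm_comp_le {α β : Type*} [MeasurableSpace α] [MeasurableSpace β] {μ : Measure α}
    {ν : Measure β} {g : α → β} {c : ℝ≥0∞} (hg : Measurable g)
    (hle : Measure.map g μ ≤ c • ν) {f : β → ℝ} (hf : AEStronglyMeasurable f ν) (p : ℝ≥0∞) :
    eLpNorm (fun x => f (g x)) p μ ≤ c ^ (1 / p).toReal * eLpNorm f p ν := by
  have h := eLpNorm_map_measure (p := p)
    (hf.mono_ac (Measure.absolutelyContinuous_of_le_smul hle)) hg.aemeasurable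
  exact h.symm.trans_le (eLpNorm_le_of_measure_le_smul hle)

theorem ae_ae_swap {μ ν : Measure ℝ} [SFinite μ] [SFinite ν] {P : ℝ × ℝ → Prop}
    (h : ∀ᵐ p ∂μ.prod ν, P p) : ∀ᵐ y ∂ν, ∀ᵐ x ∂μ, P (x, y) := by
  refine Measure.ae_ae_of_ae_prod (p := fun q : ℝ × ℝ => P (q.2, q.1)) ?_
  exact (Measure.measurePreserving_swap (μ := ν) (ν := μ)).quasiMeasurePreserving.ae h

/-! ### Comparison of the travel times -/

section

variable {k m : ℕ} {lam : Idx k m → ℝ → ℝ}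

theorem AdmissibleSpeeds.continuousOn (h : AdmissibleSpeeds lam) (i : Idx k m) :
    ContinuousOn (lam i) (Icc 0 1) :=
  (h.lipschitz i).choose_spec.continuousOn

theorem AdmissibleSpeeds.exists_isTravelTime (h : AdmissibleSpeeds lam) (i : Idx k m) :
    ∃ (K : ℝ≥0) (φ : ℝ ≃o ℝ), IsTravelTime (lam i) K φ :=
  HypControl.exists_isTravelTime (h.continuousOn i) (h.pos i)

theorem AdmissibleSpeeds.tau_le (h : AdmissibleSpeeds lam) {a b : Idx k m}
    (hab : ∀ x ∈ Icc (0 : ℝ) 1, lam a x ≤ lam b x) : tau lam b ≤ tau lam a := by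
  have hi : ∀ i, IntervalIntegrable (fun x => 1 / lam i x) volume 0 1 := fun i => by
    apply ContinuousOn.intervalIntegrable
    rw [uIcc_of_le zero_le_one]
    exact continuousOn_const.div (h.continuousOn i) fun x hx => (h.pos i x hx).ne'
  exact intervalIntegral.integral_mono_on zero_le_one (hi b) (hi a) fun x hx =>
    one_div_le_one_div_of_le (h.pos a x hx) (hab x hx)

theorem AdmissibleSpeeds.tau_inl_mono (h : AdmissibleSpeeds lam) {a b : Fin k} (hab : a ≤ b) :
    tau lam (Sum.inl a) ≤ tau lam (Sum.inl b) := by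
  refine h.tau_le fun x hx => ?_
  rcases hab.eq_or_lt with rfl | hlt
  · exact le_rfl
  · linarith [h.strict_neg x hx a b hlt]

theorem AdmissibleSpeeds.tau_inr_anti (h : AdmissibleSpeeds lam) {a b : Fin m} (hab : a ≤ b) :
    tau lam (Sum.inr b) ≤ tau lam (Sum.inr a) := by
  refine h.tau_le fun x hx => ?_
  rcases hab.eq_or_lt with rfl | hlt
  · exact le_rfl
  · exact (h.strict_pos x hx a b hlt).le

/-- Counting from the end unifies the two formulas for the optimal time: with zero-based indices,
every sum in either formula pairs `k - p` with `m - p`, and `p` is the size of the trailing block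
used later. -/
theorem lt_of_lt_optimalTime [NeZero k] [NeZero m] {T : ℝ} (hT : T < optimalTime lam) :
    T < tau lam (Sum.inr 0) ∨ ∃ (p : ℕ) (hk : p ≤ k) (hm : p ≤ m) (hp : 1 ≤ p),
      T < tau lam (Sum.inl ⟨k - p, by omega⟩) + tau lam (Sum.inr ⟨m - p, by omega⟩) := by
  unfold optimalTime at hT
  split_ifs at hT with h
  · rcases lt_max_iff.1 hT with hT | hT
    · obtain ⟨i, hi⟩ := exists_lt_of_lt_ciSup hT
      refine Or.inr ⟨k - i, by omega, by omega, by omega, ?_⟩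
      convert hi using 5 <;> first | rfl | omega
    · exact Or.inl hT
  · obtain ⟨j, hj⟩ := exists_lt_of_lt_ciSup hT
    refine Or.inr ⟨m - j, by omega, by omega, by omega, ?_⟩
    convert hj using 5 <;> first | rfl | omega

end

/-! ### Traces of broad solutions -/

section

variable {k m : ℕ} {lam : Idx k m → ℝ → ℝ} {B : Matrix (Fin k) (Fin m) ℝ} {T : ℝ}
  {w₀ : ℝ → Idx k m → ℝ} {W : ℝ → Fin m → ℝ} {w : ℝ → ℝ → Idx k m → ℝ}

namespace IsBroadSolution

theorem ae_eq_of_isCharacteristic (hw : IsBroadSolution lam 0 B T w₀ W w) (i : Idx k m) :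
    ∀ᵐ p : ℝ × ℝ ∂(volume.restrict (Ioo 0 T ×ˢ Ioo 0 1)),
      ∀ (s : ℝ) (γ : ℝ → ℝ), 0 ≤ s → IsCharacteristic lam i γ s p.1 → γ p.1 = p.2 →
        (s = 0 ∨ γ s = inflow i) → w p.1 p.2 i = w s (γ s) i := by
  filter_upwards [hw.equation i] with p hp s γ h1 h2 h3 h4
  simpa using hp s γ h1 h2 h3 h4

/-- A component entering at `x = 1` keeps its constant initial value until the characteristic from
the corner `(0, 1)` has passed. -/
theorem inr_ae_eq_initial (hw : IsBroadSolution lam 0 B T w₀ W w) {j : Fin m} {K : ℝ≥0}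
    {φ : ℝ ≃o ℝ} (hφ : IsTravelTime (lam (Sum.inr j)) K φ) {c : ℝ}
    (hc : ∀ x, w₀ x (Sum.inr j) = c) :
    ∀ᵐ p : ℝ × ℝ ∂((volume.restrict (Ioo 0 T)).prod (volume.restrict (Ioo 0 1))),
      p.1 + φ p.2 < φ 1 → w p.1 p.2 (Sum.inr j) = c := by
  -- The foot at time 0 of the characteristic through `(t, x)` is `φ.symm (t + φ x)`. Null sets of
  -- feet must pull back to null sets of points, so that the initial condition can be used at almost
  -- every point.
  have hq : Measure.QuasiMeasurePreserving (fun p : ℝ × ℝ => φ.symm (p.1 + φ p.2))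
      (volume.prod volume) volume := by
    refine QuasiMeasurePreserving.prod_of_right ?_ (ae_of_all _ fun t => ?_)
    · have h1 := φ.continuous
      have h2 := φ.symm.continuous
      exact Continuous.measurable (by fun_prop)
    · exact hφ.quasiMeasurePreserving_symm.comp
        ((quasiMeasurePreserving_add_left volume t).comp hφ.quasiMeasurePreserving)
  have hini := hq.ae ((ae_restrict_iff' measurableSet_Ioo).1 hw.initial)
  have heq := hw.ae_eq_of_isCharacteristic (Sum.inr j)
  have hmem := ae_restrict_mem (μ := (volume : Measure (ℝ × ℝ)))
    (measurableSet_Ioo.prod measurableSet_Ioo : MeasurableSet (Ioo 0 T ×ˢ Ioo (0 : ℝ) 1))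
  rw [Measure.prod_restrict]
  filter_upwards [ae_restrict_of_ae hini, heq, hmem] with p hp1 hp2 hp hlt
  obtain ⟨⟨ht0, htT⟩, hx0, hx1⟩ := hp
  have hφx : 0 < φ p.2 := by rw [← hφ.map_zero]; exact φ.strictMono hx0
  rw [hp2 0 (fun r => φ.symm ((p.1 + φ p.2) + -1 * r)) le_rfl ⟨ht0.le, fun r hr => ?_⟩ (by simp)
    (Or.inl rfl)]
  · simp only [mul_zero, add_zero]
    rw [hp1 (hφ.symm_mem_Ioo.2 ⟨by linarith, hlt⟩), hc]
  · have hmem : φ.symm ((p.1 + φ p.2) + -1 * r) ∈ Icc (0 : ℝ) 1 :=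
      hφ.symm_mem_Icc.2 ⟨by linarith [hr.2], by linarith [hr.1]⟩
    refine ⟨hmem, ?_⟩
    have := hφ.hasDerivWithinAt_symm (p.1 + φ p.2) (-1) r (Icc 0 p.1) hmem
    simpa [sigma] using this

/-- A component entering at `x = 0` is transported from `x = 0` behind the characteristic from the
corner `(0, 0)`. -/
theorem inl_ae_eq_trace (hw : IsBroadSolution lam 0 B T w₀ W w) {i : Fin k} {K : ℝ≥0}
    {φ : ℝ ≃o ℝ} (hφ : IsTravelTime (lam (Sum.inl i)) K φ) :
    ∀ᵐ p : ℝ × ℝ ∂((volume.restrict (Ioo 0 T)).prod (volume.restrict (Ioo 0 1))),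
      φ p.2 < p.1 → w p.1 p.2 (Sum.inl i) = w (p.1 - φ p.2) 0 (Sum.inl i) := by
  have heq := hw.ae_eq_of_isCharacteristic (Sum.inl i)
  have hmem := ae_restrict_mem (μ := (volume : Measure (ℝ × ℝ)))
    (measurableSet_Ioo.prod measurableSet_Ioo : MeasurableSet (Ioo 0 T ×ˢ Ioo (0 : ℝ) 1))
  have hsymm0 : φ.symm 0 = 0 := by rw [φ.symm_apply_eq, hφ.map_zero]
  rw [Measure.prod_restrict]
  filter_upwards [heq, hmem] with p hp2 hp hlt
  obtain ⟨⟨ht0, htT⟩, hx0, hx1⟩ := hp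
  have hφx : 0 < φ p.2 := by rw [← hφ.map_zero]; exact φ.strictMono hx0
  have hφx1 : φ p.2 < φ 1 := φ.strictMono hx1
  rw [hp2 (p.1 - φ p.2) (fun r => φ.symm ((φ p.2 - p.1) + 1 * r)) (by linarith)
    ⟨by linarith, fun r hr => ?_⟩ (by simp) (Or.inr (by simp [inflow, hsymm0]))]
  · simp [hsymm0]
  · have hmem : φ.symm ((φ p.2 - p.1) + 1 * r) ∈ Icc (0 : ℝ) 1 :=
      hφ.symm_mem_Icc.2 ⟨by linarith [hr.1], by linarith [hr.2]⟩
    refine ⟨hmem, ?_⟩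
    have := hφ.hasDerivWithinAt_symm (φ p.2 - p.1) 1 r (Icc (p.1 - φ p.2) p.1) hmem
    simpa [sigma] using this

/-- At each time `t < T`, the points with `φ x < φ 1 - T` lie ahead of the characteristic from the
corner `(0, 1)`; the value at time `T` is the `L²` limit along good times. -/
theorem inr_trace_final (hw : IsBroadSolution lam 0 B T w₀ W w) (hT : 0 < T) {j : Fin m} {K : ℝ≥0}
    {φ : ℝ ≃o ℝ} (hφ : IsTravelTime (lam (Sum.inr j)) K φ) {c : ℝ}
    (hc : ∀ x, w₀ x (Sum.inr j) = c) :
    ∀ᵐ x ∂(volume.restrict (Ioo 0 (φ.symm (φ 1 - T)))), w T x (Sum.inr j) = c := by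
  have hTmem : T ∈ Icc 0 T := right_mem_Icc.2 hT.le
  have hle : φ.symm (φ 1 - T) ≤ 1 := by rw [φ.symm_apply_le]; linarith
  refine ae_eq_const_of_tendsto (Ioo_subset_Ioo_right hle)
    (hw.memLp_space (Sum.inr j) T hTmem).aestronglyMeasurable
    (hw.continuous_time (Sum.inr j) T hTmem) ?_
  have h := Measure.ae_ae_of_ae_prod (hw.inr_ae_eq_initial hφ hc)
  refine (frequently_nhdsWithin_of_ae hT hTmem h).mono fun t ht => ?_
  filter_upwards [ae_restrict_of_ae_restrict_of_subset (Ioo_subset_Ioo_right hle) ht.2,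
    ae_restrict_mem measurableSet_Ioo] with x hx hxm
  have := φ.lt_symm_apply.1 hxm.2
  exact hx (by linarith [ht.1.2])

/-- Since `v < φ 1`, all points with `t < v` and `x` close enough to 0 lie ahead of the corner
characteristic; let `x` tend to 0 along good slices. -/
theorem inr_trace_zero (hw : IsBroadSolution lam 0 B T w₀ W w) {j : Fin m} {K : ℝ≥0}
    {φ : ℝ ≃o ℝ} (hφ : IsTravelTime (lam (Sum.inr j)) K φ) {c : ℝ}
    (hc : ∀ x, w₀ x (Sum.inr j) = c) {u v : ℝ} (hu : 0 ≤ u) (hvT : v ≤ T) (hv : v < φ 1) :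
    ∀ᵐ t ∂(volume.restrict (Ioo u v)), w t 0 (Sum.inr j) = c := by
  have h0 : (0 : ℝ) ∈ Icc (0 : ℝ) 1 := left_mem_Icc.2 zero_le_one
  have hsub : Ioo u v ⊆ Ioo 0 T := Ioo_subset_Ioo hu hvT
  refine ae_eq_const_of_tendsto (f := fun x t => w t x (Sum.inr j)) hsub
    (hw.memLp_time (Sum.inr j) 0 h0).aestronglyMeasurable
    (hw.continuous_space (Sum.inr j) 0 h0) ?_
  have h := ae_ae_swap (hw.inr_ae_eq_initial hφ hc)
  have hnear : ∀ᶠ x in 𝓝[Icc (0 : ℝ) 1] 0, φ x < φ 1 - v := by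
    refine nhdsWithin_le_nhds (φ.continuous.continuousAt.eventually_lt_const ?_)
    rw [hφ.map_zero]; linarith
  refine ((frequently_nhdsWithin_of_ae one_pos h0 h).and_eventually hnear).mono fun x hx => ?_
  filter_upwards [ae_restrict_of_ae_restrict_of_subset hsub hx.1.2,
    ae_restrict_mem measurableSet_Ioo] with t ht htm
  exact ht (by linarith [htm.2, hx.2])

/-- What leaves `x = 0` during `(u, v)` is still inside the interval at times `t` just below `T`.
Changing variables from `s` to the position at time `t` bounds the norm of the trace by `K ^ (1/2)`
times the `L²` distance between the states at times `t` and `T`, which tends to 0. -/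
theorem inl_trace_zero (hw : IsBroadSolution lam 0 B T w₀ W w) {i : Fin k} {K : ℝ≥0}
    {φ : ℝ ≃o ℝ} (hφ : IsTravelTime (lam (Sum.inl i)) K φ)
    (hz : ∀ᵐ x ∂(volume.restrict (Ioo (0 : ℝ) 1)), w T x = 0) {u v : ℝ} (hT : 0 < T) (hu : 0 ≤ u)
    (huT : T - φ 1 ≤ u) (hv : v < T) :
    ∀ᵐ t ∂(volume.restrict (Ioo u v)), w t 0 (Sum.inl i) = 0 := by
  have hTmem : T ∈ Icc 0 T := right_mem_Icc.2 hT.le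
  have hm : AEStronglyMeasurable (fun t => w t 0 (Sum.inl i)) (volume.restrict (Ioo u v)) :=
    (hw.memLp_time (Sum.inl i) 0 (left_mem_Icc.2 zero_le_one)).aestronglyMeasurable.mono_set
      (Ioo_subset_Ioo hu hv.le)
  suffices h0 : eLpNorm (fun t => w t 0 (Sum.inl i)) 2 (volume.restrict (Ioo u v)) = 0 by
    rw [eLpNorm_eq_zero_iff hm two_ne_zero] at h0
    exact h0
  have hK : (K : ℝ≥0∞) ^ (1 / (2 : ℝ≥0∞)).toReal ≠ ∞ :=
    ENNReal.rpow_ne_top_of_nonneg ENNReal.toReal_nonneg ENNReal.coe_ne_top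
  refine eq_zero_of_frequently_le hK (hw.continuous_time (Sum.inl i) T hTmem) ?_
  have h := Measure.ae_ae_of_ae_prod (hw.inl_ae_eq_trace hφ)
  have hnear : ∀ᶠ t in 𝓝[Icc 0 T] T, v < t := nhdsWithin_le_nhds (lt_mem_nhds hv)
  refine ((frequently_nhdsWithin_of_ae hT hTmem h).and_eventually hnear).mono fun t ht => ?_
  obtain ⟨⟨⟨ht0, htT⟩, hae⟩, hvt⟩ := ht
  -- The position at time `t` of the characteristic that left `x = 0` at time `s`.
  set g : ℝ → ℝ := fun s => φ.symm (t - s) with hg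
  have hgm : Measurable g := φ.symm.continuous.measurable.comp (measurable_const_sub t)
  have hgmap : Measure.map g volume ≤ (K : ℝ≥0∞) • (volume : Measure ℝ) := by
    have := hφ.map_symm_le
    rwa [← (Measure.measurePreserving_sub_left volume t).map_eq,
      Measure.map_map φ.symm.continuous.measurable (measurable_const_sub t),
      (Measure.measurePreserving_sub_left volume t).map_eq] at this
  have hsub : Ioo u v ⊆ g ⁻¹' Ioo 0 1 := fun s hs =>
    hφ.symm_mem_Ioo.2 ⟨by linarith [hs.2], by linarith [hs.1]⟩
  have hmap : Measure.map g (volume.restrict (Ioo u v)) ≤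
      (K : ℝ≥0∞) • (volume.restrict (Ioo (0 : ℝ) 1)) := by
    calc Measure.map g (volume.restrict (Ioo u v))
        ≤ Measure.map g (volume.restrict (g ⁻¹' Ioo 0 1)) :=
          Measure.map_mono (Measure.restrict_mono hsub le_rfl) hgm
      _ = (Measure.map g volume).restrict (Ioo 0 1) :=
          (Measure.restrict_map hgm measurableSet_Ioo).symm
      _ ≤ ((K : ℝ≥0∞) • (volume : Measure ℝ)).restrict (Ioo 0 1) :=
          Measure.restrict_mono le_rfl hgmap
      _ = _ := Measure.restrict_smul _ _ _
  have hqmp : Measure.QuasiMeasurePreserving g (volume.restrict (Ioo u v))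
      (volume.restrict (Ioo (0 : ℝ) 1)) :=
    ⟨hgm, Measure.absolutelyContinuous_of_le_smul hmap⟩
  have hmeas : AEStronglyMeasurable (fun x => w t x (Sum.inl i) - w T x (Sum.inl i))
      (volume.restrict (Ioo (0 : ℝ) 1)) :=
    ((hw.memLp_space (Sum.inl i) t ⟨ht0.le, htT.le⟩).sub
      (hw.memLp_space (Sum.inl i) T hTmem)).aestronglyMeasurable
  refine le_trans (le_of_eq (eLpNorm_congr_ae ?_)) (eLpNorm_comp_le hgm hmap hmeas 2)
  filter_upwards [hqmp.ae hae, hqmp.ae hz, ae_restrict_mem measurableSet_Ioo] with s h1 h2 hs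
  have hφg : φ (g s) = t - s := φ.apply_symm_apply _
  rw [hφg, sub_sub_cancel] at h1
  rw [h1 (by linarith [hs.1]), h2]
  simp

end IsBroadSolution

/-! ### Initial data that cannot be steered to zero -/

theorem exists_mem_of_ae_restrict {u v : ℝ} (huv : u < v) {P : ℝ → Prop}
    (h : ∀ᵐ x ∂(volume.restrict (Ioo u v)), P x) : ∃ x ∈ Ioo u v, P x := by
  have : NeBot (ae (volume.restrict (Ioo u v))) := by
    rw [ae_neBot, Ne, Measure.restrict_eq_zero, Real.volume_Ioo]
    simpa using huv
  exact ((ae_restrict_mem measurableSet_Ioo).and h).exists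

/-- The characteristic from `(0, 1)` has not reached `x = 0` by time `T`, so no control has acted on
a whole interval next to 0. -/
theorem not_ae_eq_zero_of_lt_tau_inr (hlam : AdmissibleSpeeds lam) {j : Fin m} (hT0 : 0 ≤ T)
    (hT : T < tau lam (Sum.inr j))
    (hw : IsBroadSolution lam 0 B T (fun _ => Pi.single (Sum.inr j) 1) W w) :
    ¬ ∀ᵐ x ∂(volume.restrict (Ioo (0 : ℝ) 1)), w T x = 0 := by
  intro hz
  rcases hT0.eq_or_lt with rfl | hpos
  · obtain ⟨x, -, h1, h2⟩ := exists_mem_of_ae_restrict one_pos (hz.and hw.initial)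
    have := congrFun (h1.symm.trans h2) (Sum.inr j)
    simp at this
  · obtain ⟨K, φ, hφ⟩ := hlam.exists_isTravelTime (Sum.inr j)
    have hτ : T < φ 1 := by rw [hφ.map_one]; exact hT
    have h := hw.inr_trace_final hpos hφ (c := 1) (by simp)
    have hlt : 0 < φ.symm (φ 1 - T) := by rw [φ.lt_symm_apply, hφ.map_zero]; linarith
    have hle : φ.symm (φ 1 - T) ≤ 1 := by rw [φ.symm_apply_le]; linarith
    obtain ⟨x, -, h1, h2⟩ := exists_mem_of_ae_restrict hlt
      (h.and (ae_restrict_of_ae_restrict_of_subset (Ioo_subset_Ioo_right hle) hz))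
    rw [h2] at h1
    simp at h1

/-- If the trailing `p × p` block of `B` is invertible, then a vector in the kernel of the last `p`
rows of `B` whose first `m - p` entries vanish is zero. -/
theorem apply_eq_zero_of_trailingBlock {p : ℕ} (hk : p ≤ k) (hm : p ≤ m)
    (hB : IsUnit (trailingBlock B p hk hm)) {y : Fin m → ℝ}
    (hy : ∀ j : Fin m, (j : ℕ) < m - p → y j = 0)
    (hBy : ∀ i : Fin k, k - p ≤ (i : ℕ) → ∑ j, B i j * y j = 0) (j : Fin m) : y j = 0 := by
  set e : Fin p → Fin m := fun b => ⟨m - p + b, by omega⟩ with he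
  have hinj : Function.Injective e := fun a b hab => by
    simp only [he, Fin.mk.injEq] at hab
    exact Fin.ext (by omega)
  have hrange : ∀ j : Fin m, j ∉ Set.range e → y j = 0 := fun j hj => by
    refine hy j (not_le.1 fun hle => hj ⟨⟨j - (m - p), by omega⟩, Fin.ext ?_⟩)
    simp only [he]
    omega
  have hmul : trailingBlock B p hk hm *ᵥ (y ∘ e) = trailingBlock B p hk hm *ᵥ 0 := by
    rw [Matrix.mulVec_zero]
    ext a
    have ha := hBy ⟨k - p + a, by omega⟩ (by simp)
    rw [Pi.zero_apply, ← ha]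
    exact Fintype.sum_of_injective e hinj _ _ (fun j hj => by rw [hrange j hj, mul_zero])
      fun b => rfl
  have hzero := Matrix.mulVec_injective_of_isUnit hB hmul
  by_cases hj : j ∈ Set.range e
  · obtain ⟨b, rfl⟩ := hj
    exact congrFun hzero b
  · exact hrange j hj

theorem not_ae_eq_zero_of_lt_tau_add (hlam : AdmissibleSpeeds lam) {p : ℕ} (hk : p ≤ k)
    (hm : p ≤ m) (hp : 1 ≤ p) (hB : IsUnit (trailingBlock B p hk hm)) (hT0 : 0 ≤ T)
    (hT : T < tau lam (Sum.inl ⟨k - p, by omega⟩) + tau lam (Sum.inr ⟨m - p, by omega⟩))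
    (hw : IsBroadSolution lam 0 B T (fun _ => Pi.single (Sum.inr ⟨m - p, by omega⟩) 1) W w) :
    ¬ ∀ᵐ x ∂(volume.restrict (Ioo (0 : ℝ) 1)), w T x = 0 := by
  rcases hT0.eq_or_lt with rfl | hpos
  · refine not_ae_eq_zero_of_lt_tau_inr hlam le_rfl ?_ hw
    obtain ⟨K, φ, hφ⟩ := hlam.exists_isTravelTime (Sum.inr ⟨m - p, by omega⟩)
    exact hφ.map_one_pos.trans_eq hφ.map_one
  intro hz
  choose K φ hφ using hlam.exists_isTravelTime
  have hτ : ∀ i, φ i 1 = tau lam i := fun i => (hφ i).map_one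
  set α := tau lam (Sum.inl ⟨k - p, by omega⟩) with hα
  set β := tau lam (Sum.inr ⟨m - p, by omega⟩) with hβ
  have hαpos : 0 < α := by rw [hα, ← hτ]; exact (hφ _).map_one_pos
  have hβpos : 0 < β := by rw [hβ, ← hτ]; exact (hφ _).map_one_pos
  -- The only place where `T < α + β` is needed: the window of times at `x = 0` is nonempty.
  have hlt : max 0 (T - α) < min T β :=
    max_lt (lt_min hpos hβpos) (lt_min (by linarith) (by linarith))
  obtain ⟨v, huv, hv⟩ := exists_between hlt
  set u := max 0 (T - α) with hu
  have hu0 : 0 ≤ u := le_max_left _ _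
  have huT : T - α ≤ u := le_max_right _ _
  have hvT : v < T := hv.trans_le (min_le_left _ _)
  have hvβ : v < β := hv.trans_le (min_le_right _ _)
  have h1 : ∀ᵐ t ∂(volume.restrict (Ioo u v)), ∀ i : Fin k, k - p ≤ (i : ℕ) →
      w t 0 (Sum.inl i) = 0 := by
    rw [ae_all_iff]
    intro i
    by_cases hi : k - p ≤ (i : ℕ)
    -- Later components of `w_-` are slower, so one time window serves all of the last `p` rows.
    · have hle : α ≤ φ (Sum.inl i) 1 := by rw [hτ]; exact hlam.tau_inl_mono hi
      filter_upwards [hw.inl_trace_zero (hφ (Sum.inl i)) hz hpos hu0 (by linarith) hvT] with t ht _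
      exact ht
    · exact ae_of_all _ fun t h => absurd h hi
  have h2 : ∀ᵐ t ∂(volume.restrict (Ioo u v)), ∀ j : Fin m, (j : ℕ) ≤ m - p →
      w t 0 (Sum.inr j) = (Pi.single (Sum.inr ⟨m - p, by omega⟩) 1 : Idx k m → ℝ) (Sum.inr j) := by
    rw [ae_all_iff]
    intro j
    by_cases hj : (j : ℕ) ≤ m - p
    -- Earlier components of `w_+` are slower, so the control has reached none of them at `x = 0`
    -- before `β`.
    · have hle : β ≤ φ (Sum.inr j) 1 := by rw [hτ]; exact hlam.tau_inr_anti hj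
      filter_upwards [hw.inr_trace_zero (hφ (Sum.inr j)) (fun _ => rfl) hu0 hvT.le
        (hvβ.trans_le hle)] with t ht _
      exact ht
    · exact ae_of_all _ fun t h => absurd h hj
  have h3 := ae_restrict_of_ae_restrict_of_subset (Ioo_subset_Ioo hu0 hvT.le) hw.boundary_zero
  obtain ⟨t, -, ⟨ht1, ht2⟩, ht3⟩ := exists_mem_of_ae_restrict huv ((h1.and h2).and h3)
  have hcontra := apply_eq_zero_of_trailingBlock hk hm hB (y := fun j => w t 0 (Sum.inr j))
    (fun j hj => ?_) (fun i hi => (ht3 i).symm.trans (ht1 i hi)) ⟨m - p, by omega⟩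
  · simp only [ht2 ⟨m - p, by omega⟩ le_rfl, Pi.single_eq_same] at hcontra
    exact one_ne_zero hcontra
  · rw [ht2 j hj.le, Pi.single_eq_of_ne]
    intro h
    have := congrArg Fin.val (Sum.inr.inj h)
    simp only at this
    omega

end

/-! ### Existence of broad solutions -/

/-- Continuity of translations in `L²`, read off from continuity of composition with a continuously
varying family of measure-preserving maps. -/
theorem tendsto_eLpNorm_translate {F : ℝ → ℝ} (hF : MemLp F 2 volume) (a₀ : ℝ) :
    Tendsto (fun a => eLpNorm (fun s => F (a + s) - F (a₀ + s)) 2 volume) (𝓝 a₀) (𝓝 0) := by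
  let g : C(ℝ, C(ℝ, ℝ)) := ContinuousMap.curry ⟨fun p : ℝ × ℝ => p.1 + p.2, continuous_add⟩
  have hgm : ∀ a, MeasurePreserving (g a) volume volume := fun a =>
    measurePreserving_add_left volume a
  have hc := (continuous_const (y := hF.toLp F)).compMeasurePreservingLp g.continuous hgm
    ENNReal.ofNat_ne_top
  have h := tendsto_iff_edist_tendsto_0.1 (hc.tendsto a₀)
  refine h.congr fun a => ?_
  rw [Lp.toLp_compMeasurePreserving, Lp.toLp_compMeasurePreserving, Lp.edist_toLp_toLp]
  rfl

section Wave

variable {F θ : ℝ → ℝ} {K : ℝ≥0}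

theorem memLp_wave_space (hF : MemLp F 2 volume) (hθ : Measurable θ)
    (hmap : Measure.map θ volume ≤ (K : ℝ≥0∞) • (volume : Measure ℝ)) (t : ℝ) :
    MemLp (fun x => F (t + θ x)) 2 volume := by
  have h1 : MemLp (fun s => F (t + s)) 2 volume :=
    hF.comp_measurePreserving (measurePreserving_add_left volume t)
  exact (h1.of_measure_le_smul ENNReal.coe_ne_top hmap).comp_of_map hθ.aemeasurable

theorem memLp_wave_time (hF : MemLp F 2 volume) (a : ℝ) :
    MemLp (fun t => F (t + a)) 2 volume :=
  hF.comp_measurePreserving (measurePreserving_add_right volume a)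

/-- The wave is the pullback of `F(t)` under the shear `t ↦ t + θ x`, which preserves the measure on
the strip `ℝ × (0,1)`. The strip has finite width, so `F(t)` is square integrable there. -/
theorem memLp_wave (hF : MemLp F 2 volume) (hθ : Measurable θ) (T : ℝ) :
    MemLp (fun p : ℝ × ℝ => F (p.1 + θ p.2)) 2 (volume.restrict (Ioo 0 T ×ˢ Ioo 0 1)) := by
  have hshear : MeasurePreserving (fun q : ℝ × ℝ => (q.1, q.2 + θ q.1))
      ((volume.restrict (Ioo (0 : ℝ) 1)).prod volume)
      ((volume.restrict (Ioo (0 : ℝ) 1)).prod volume) :=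
    (MeasurePreserving.id _).skew_product (g := fun x t => t + θ x)
      (measurable_snd.add (hθ.comp measurable_fst))
      (ae_of_all _ fun x => (measurePreserving_add_right volume (θ x)).map_eq)
  have h1 : MemLp (fun q : ℝ × ℝ => F q.2) 2 ((volume.restrict (Ioo (0 : ℝ) 1)).prod volume) :=
    hF.comp_snd _
  have h2 := (h1.comp_measurePreserving hshear).comp_measurePreserving
    (Measure.measurePreserving_swap (μ := (volume : Measure ℝ)))
  refine h2.mono_measure ?_
  have hr := Measure.prod_restrict (μ := (volume : Measure ℝ)) (ν := volume) univ (Ioo (0 : ℝ) 1)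
  rw [Measure.restrict_univ] at hr
  rw [hr]
  exact Measure.restrict_mono (prod_mono_left (subset_univ _)) le_rfl

theorem tendsto_wave_time (hF : MemLp F 2 volume) (hθ : Measurable θ)
    (hmap : Measure.map θ volume ≤ (K : ℝ≥0∞) • (volume : Measure ℝ)) (t₀ : ℝ) :
    Tendsto (fun t => eLpNorm (fun x => F (t + θ x) - F (t₀ + θ x)) 2 volume)
      (𝓝 t₀) (𝓝 0) := by
  have hK : (K : ℝ≥0∞) ^ (1 / (2 : ℝ≥0∞)).toReal ≠ ∞ :=
    ENNReal.rpow_ne_top_of_nonneg ENNReal.toReal_nonneg ENNReal.coe_ne_top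
  have h := ENNReal.Tendsto.const_mul (tendsto_eLpNorm_translate hF t₀) (Or.inr hK)
  rw [mul_zero] at h
  refine tendsto_of_tendsto_of_tendsto_of_le_of_le tendsto_const_nhds h (fun _ => zero_le)
    fun t => ?_
  have ht : ∀ t : ℝ, MemLp (fun s => F (t + s)) 2 volume := fun t =>
    hF.comp_measurePreserving (measurePreserving_add_left volume t)
  exact eLpNorm_comp_le hθ hmap ((ht t).sub (ht t₀)).aestronglyMeasurable 2

theorem tendsto_wave_space (hF : MemLp F 2 volume) (hθ : Continuous θ) (x₀ : ℝ) :
    Tendsto (fun x => eLpNorm (fun t => F (t + θ x) - F (t + θ x₀)) 2 volume)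
      (𝓝 x₀) (𝓝 0) := by
  simpa only [add_comm, Function.comp_def] using
    (tendsto_eLpNorm_translate hF (θ x₀)).comp (hθ.tendsto x₀)

end Wave

section

variable {k m : ℕ} {lam : Idx k m → ℝ → ℝ} {B : Matrix (Fin k) (Fin m) ℝ} {T : ℝ}

/-- Along the characteristics of the `i`-th equation, `t + phase φ i x` is constant. -/
noncomputable def phase (φ : Idx k m → ℝ ≃o ℝ) : Idx k m → ℝ → ℝ
  | Sum.inl i => fun x => -φ (Sum.inl i) x
  | Sum.inr j => fun x => φ (Sum.inr j) x

theorem continuous_phase (φ : Idx k m → ℝ ≃o ℝ) (i : Idx k m) : Continuous (phase φ i) := by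
  cases i with
  | inl i => exact (φ (Sum.inl i)).continuous.neg
  | inr j => exact (φ (Sum.inr j)).continuous

theorem map_phase_le {φ : Idx k m → ℝ ≃o ℝ} {K : Idx k m → ℝ≥0}
    (hφ : ∀ i, IsTravelTime (lam i) (K i) (φ i)) (i : Idx k m) :
    Measure.map (phase φ i) volume ≤ (K i : ℝ≥0∞) • (volume : Measure ℝ) := by
  cases i with
  | inl i =>
    have h := Measure.map_mono (hφ (Sum.inl i)).map_le measurable_neg
    rwa [Measure.map_map measurable_neg (φ (Sum.inl i)).continuous.measurable, Measure.map_smul,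
      (Measure.measurePreserving_neg volume).map_eq] at h
  | inr j => exact (hφ (Sum.inr j)).map_le

/-- A broad solution is tested on every characteristic, not just the explicit ones; this
conservation law handles them all and replaces ODE uniqueness. -/
theorem phase_add_eq (hlam : AdmissibleSpeeds lam) {φ : Idx k m → ℝ ≃o ℝ} {K : Idx k m → ℝ≥0}
    (hφ : ∀ i, IsTravelTime (lam i) (K i) (φ i)) {i : Idx k m} {γ : ℝ → ℝ} {s t : ℝ}
    (hγ : IsCharacteristic lam i γ s t) : t + phase φ i (γ t) = s + phase φ i (γ s) := by
  cases i with
  | inl i =>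
    have := (hφ (Sum.inl i)).apply_sub_eq (ε := 1) hγ.1 (hlam.pos _)
      fun r hr => by simpa [sigma] using hγ.2 r hr
    simp only [phase]
    linarith
  | inr j =>
    have := (hφ (Sum.inr j)).apply_sub_eq (ε := -1) hγ.1 (hlam.pos _)
      fun r hr => by simpa [sigma] using hγ.2 r hr
    simp only [phase]
    linarith

/-- Superpositions of travelling waves whose profiles are compatible with the initial and boundary
conditions are broad solutions. -/
theorem isBroadSolution_wave (hlam : AdmissibleSpeeds lam) {φ : Idx k m → ℝ ≃o ℝ}
    {K : Idx k m → ℝ≥0} (hφ : ∀ i, IsTravelTime (lam i) (K i) (φ i)) {P : Idx k m → ℝ → ℝ}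
    (hP : ∀ i, MemLp (P i) 2 volume) {w₀ : ℝ → Idx k m → ℝ} {W : ℝ → Fin m → ℝ}
    (hini : ∀ x ∈ Ioo (0 : ℝ) 1, ∀ i, P i (phase φ i x) = w₀ x i)
    (hzero : ∀ t ∈ Ioo 0 T, ∀ i, P (Sum.inl i) t = ∑ j, B i j * P (Sum.inr j) t)
    (hone : ∀ t ∈ Ioo 0 T, ∀ j, P (Sum.inr j) (t + φ (Sum.inr j) 1) = W t j) :
    IsBroadSolution lam 0 B T w₀ W fun t x i => P i (t + phase φ i x) where
  memLp i := memLp_wave (hP i) (continuous_phase φ i).measurable T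
  memLp_space i t _ :=
    (memLp_wave_space (hP i) (continuous_phase φ i).measurable (map_phase_le hφ i) t).restrict _
  continuous_time i t₀ _ :=
    tendsto_of_tendsto_of_tendsto_of_le_of_le tendsto_const_nhds
      ((tendsto_wave_time (hP i) (continuous_phase φ i).measurable (map_phase_le hφ i) t₀).mono_left
        nhdsWithin_le_nhds) (fun _ => zero_le)
      fun _ => eLpNorm_mono_measure _ Measure.restrict_le_self
  memLp_time i x _ := (memLp_wave_time (hP i) _).restrict _
  continuous_space i x₀ _ :=
    tendsto_of_tendsto_of_tendsto_of_le_of_le tendsto_const_nhds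
      ((tendsto_wave_space (hP i) (continuous_phase φ i) x₀).mono_left nhdsWithin_le_nhds)
      (fun _ => zero_le) fun _ => eLpNorm_mono_measure _ Measure.restrict_le_self
  initial := by
    filter_upwards [ae_restrict_mem measurableSet_Ioo] with x hx
    ext i
    rw [zero_add, hini x hx]
  boundary_zero := by
    filter_upwards [ae_restrict_mem measurableSet_Ioo] with t ht i
    simpa [phase, (hφ _).map_zero] using hzero t ht i
  boundary_one := by
    filter_upwards [ae_restrict_mem measurableSet_Ioo] with t ht j
    exact hone t ht j
  equation i := by
    refine ae_of_all _ fun p s γ _ hγ hp _ => ?_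
    have h := phase_add_eq hlam hφ hγ
    rw [hp] at h
    simp [h]

/-- Without a zeroth-order term, `w_+` is determined by its initial value and the control alone, and
`w_-` then follows by reflection at `x = 0`. The profiles are therefore explicit and no fixed point
is needed. -/
theorem exists_isBroadSolution (hlam : AdmissibleSpeeds lam) (B : Matrix (Fin k) (Fin m) ℝ)
    (T : ℝ) (c : Idx k m → ℝ) {W : ℝ → Fin m → ℝ}
    (hW : ∀ j, MemLp (fun t => W t j) 2 (volume.restrict (Ioo 0 T))) :
    ∃ w, IsBroadSolution lam 0 B T (fun _ => c) W w := by
  choose K φ hφ using hlam.exists_isTravelTime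
  have hind : ∀ (u v a : ℝ), MemLp ((Ioo u v).indicator fun _ => a) 2 volume := fun u v a =>
    memLp_indicator_const 2 measurableSet_Ioo a (Or.inr measure_Ioo_lt_top.ne)
  -- The profile is the initial value until the crossing time, then the control delayed by that
  -- time. The cut-off to `(0, T)` is needed because `W` is square integrable only there.
  set G : Fin m → ℝ → ℝ := fun j s =>
    (Ioo 0 (φ (Sum.inr j) 1)).indicator (fun _ => c (Sum.inr j)) s +
      (Ioo 0 T).indicator (fun t => W t j) (s - φ (Sum.inr j) 1) with hG
  -- Negative arguments carry the initial value, positive ones the reflected wave; the phase of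
  -- `w_-` is `-φ`.
  set F : Fin k → ℝ → ℝ := fun i s =>
    (Ioo (-φ (Sum.inl i) 1) 0).indicator (fun _ => c (Sum.inl i)) s +
      (Ioi 0).indicator (fun t => ∑ j, B i j * G j t) s with hF
  have hGmem : ∀ j, MemLp (G j) 2 volume := fun j =>
    (hind _ _ _).add (((memLp_indicator_iff_restrict measurableSet_Ioo).2 (hW j)).comp_measurePreserving
      (measurePreserving_sub_right volume _))
  have hFmem : ∀ i, MemLp (F i) 2 volume := fun i =>
    (hind _ _ _).add ((memLp_finsetSum _ fun j _ => (hGmem j).const_mul (B i j)).indicator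
      measurableSet_Ioi)
  refine ⟨_, isBroadSolution_wave hlam hφ (P := Sum.elim F G) ?_ ?_ ?_ ?_⟩
  · rintro (i | j)
    · exact hFmem i
    · exact hGmem j
  · rintro x ⟨hx0, hx1⟩ i
    have h0 : 0 < φ i x := by rw [← (hφ i).map_zero]; exact (φ i).strictMono hx0
    have h1 : φ i x < φ i 1 := (φ i).strictMono hx1
    rcases i with i | j
    · simp only [Sum.elim_inl, hF, phase]
      rw [indicator_of_mem (mem_Ioo.2 ⟨by linarith, by linarith⟩),
        indicator_of_notMem (by simpa using h0.le), add_zero]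
    · simp only [Sum.elim_inr, hG, phase]
      rw [indicator_of_mem (mem_Ioo.2 ⟨h0, h1⟩), indicator_of_notMem (fun h => by linarith [h.1]), add_zero]
  · rintro t ⟨ht0, htT⟩ i
    simp only [Sum.elim_inl, Sum.elim_inr, hF]
    rw [indicator_of_notMem (fun h => by linarith [h.2]), indicator_of_mem (mem_Ioi.2 ht0), zero_add]
  · rintro t ht j
    simp only [Sum.elim_inr, hG]
    rw [indicator_of_notMem (fun h => by linarith [h.2, ht.1]), add_sub_cancel_right,
      indicator_of_mem ht, zero_add]

end

end HypControl

/-! ### The lower bound for the control time -/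

theorem mainTheorem6 {k m : ℕ} [NeZero k] [NeZero m]
    (lam : HypControl.Idx k m → ℝ → ℝ) (hlam : HypControl.AdmissibleSpeeds lam)
    (B : Matrix (Fin k) (Fin m) ℝ)
    (hB : ∀ (i : ℕ) (hik : i ≤ k) (him : i ≤ m), 1 ≤ i →
      IsUnit (HypControl.trailingBlock B i hik him))
    (T : ℝ) (hT0 : 0 ≤ T) (hT : T < HypControl.optimalTime lam) :
    (∃ w₀ : ℝ → HypControl.Idx k m → ℝ,
      (∀ i, MemLp (fun x => w₀ x i) ∞ (volume.restrict (Ioo 0 1))) ∧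
      ∀ W : ℝ → Fin m → ℝ, (∀ j, MemLp (fun t => W t j) 2 (volume.restrict (Ioo 0 T))) →
        (∃ w : ℝ → ℝ → HypControl.Idx k m → ℝ,
          HypControl.IsBroadSolution lam 0 B T w₀ W w) ∧
        ∀ w : ℝ → ℝ → HypControl.Idx k m → ℝ,
          HypControl.IsBroadSolution lam 0 B T w₀ W w →
          ¬ ∀ᵐ x ∂(volume.restrict (Ioo (0 : ℝ) 1)), w T x = 0) ∧
    ¬ HypControl.NullControllable lam 0 B 2 T ∧
    ¬ HypControl.NullControllable lam 0 B ∞ T := by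
  obtain ⟨c, hc⟩ : ∃ c : HypControl.Idx k m → ℝ, ∀ W w,
      HypControl.IsBroadSolution lam 0 B T (fun _ => c) W w →
        ¬ ∀ᵐ x ∂(volume.restrict (Ioo (0 : ℝ) 1)), w T x = 0 := by
    rcases HypControl.lt_of_lt_optimalTime hT with h | ⟨p, hk, hm, hp, h⟩
    · exact ⟨_, fun W w hw => HypControl.not_ae_eq_zero_of_lt_tau_inr hlam hT0 h hw⟩
    · exact ⟨_, fun W w hw =>
        HypControl.not_ae_eq_zero_of_lt_tau_add hlam hk hm hp (hB p hk hm hp) hT0 h hw⟩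
  have hmem : ∀ (q : ℝ≥0∞) i, MemLp (fun _ : ℝ => c i) q (volume.restrict (Ioo 0 1)) :=
    fun q i => memLp_const _
  -- A constant datum lies in every `L^q(0,1)`, and the obstruction holds whatever the control's
  -- integrability, so one datum refutes every exponent.
  have hnot : ∀ q, ¬ HypControl.NullControllable lam 0 B q T := fun q h => by
    obtain ⟨W, -, w, hw, hz⟩ := h (fun _ => c) (hmem q)
    exact hc W w hw hz
  exact ⟨⟨fun _ => c, hmem ∞, fun W hW =>
    ⟨HypControl.exists_isBroadSolution hlam B T c hW, hc W⟩⟩, hnot 2, hnot ∞⟩
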